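/- Only edge colorings are considered, and $P_5$ denotes the path on five vertices. A colored graph is rainbow if its edges have pairwise different colors, and monochromatic if all its edges have the same color. For a graph $H$ and an integer $k\ge 1$, let $R_k(H)$ be the least $N$ such that every coloring of the edges of $K_N$ using at most $k$ colors contains a monochromatic copy of $H$; for graphs $G$ and $H$, let $gr_k(G:H)$ be the least $N$ such that every coloring of the edges of $K_N$ using at most $k$ colors contains a rainbow copy of $G$ or a monochromatic copy of $H$. Write $nK_r$ for the disjoint union of $n$ copies of the complete graph $K_r$. Theorem. Let $r\ge 3$ and $2\le n\le r-1$. Then $R_3(nK_r)$ and, for every integer $k\ge 1$, $gr_k(P_5:nK_r)$ exist, and $$gr_k(P_5:nK_r)\le R_3(nK_r)\quad\text{for every } k\ge 1,$$ with equality $$gr_k(P_5:nK_r)=R_3(nK_r)\quad\text{for every } k\ge 3.$$ -/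

import Mathlib

open SimpleGraph

/-- The disjoint union of `n` copies of a graph `H`, usually written `nH`. -/
def disjointCopies (n : ℕ) {V : Type*} (H : SimpleGraph V) : SimpleGraph (Fin n × V) where
  Adj x y := x.1 = y.1 ∧ H.Adj x.2 y.2
  symm := ⟨fun _ _ h => ⟨h.1.symm, h.2.symm⟩⟩
  loopless := ⟨fun _ h => H.irrefl h.2⟩

/-- The edge coloring `C` of the complete graph on `W` contains a monochromatic copy of `H`:
a (not necessarily induced) copy of `H` all of whose edges have a single color. -/
def HasMonochromaticCopy {W K V : Type*} (C : TopEdgeLabeling W K) (H : SimpleGraph V) : Prop :=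
  ∃ c : K, H ⊑ C.labelGraph c

/-- The edge coloring `C` of the complete graph on `W` contains a rainbow copy of `G`:
a (not necessarily induced) copy of `G` whose edges have pairwise different colors. -/
def HasRainbowCopy {W K V : Type*} (C : TopEdgeLabeling W K) (G : SimpleGraph V) : Prop :=
  ∃ f : Copy G (⊤ : SimpleGraph W), Function.Injective fun e : G.edgeSet => C (f.mapEdgeSet e)

/-- The set of all `N` such that every coloring of the edges of `K_N` using at most `k` colors
contains a monochromatic copy of `H`. -/
def ramseySet (k : ℕ) {V : Type*} (H : SimpleGraph V) : Set ℕ :=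
  {N | ∀ C : TopEdgeLabeling (Fin N) (Fin k), HasMonochromaticCopy C H}

/-- The `k`-color Ramsey number `R_k(H)`, the least element of `ramseySet k H`
(meaningful when that set is nonempty). -/
noncomputable def ramseyNumber (k : ℕ) {V : Type*} (H : SimpleGraph V) : ℕ :=
  sInf (ramseySet k H)

/-- The set of all `N` such that every coloring of the edges of `K_N` using at most `k` colors
contains a rainbow copy of `G` or a monochromatic copy of `H`. -/
def gallaiRamseySet (k : ℕ) {U V : Type*} (G : SimpleGraph U) (H : SimpleGraph V) : Set ℕ :=
  {N | ∀ C : TopEdgeLabeling (Fin N) (Fin k), HasRainbowCopy C G ∨ HasMonochromaticCopy C H}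

/-- The Gallai-Ramsey number `gr_k(G : H)`, the least element of `gallaiRamseySet k G H`
(meaningful when that set is nonempty). -/
noncomputable def gallaiRamseyNumber (k : ℕ) {U V : Type*}
    (G : SimpleGraph U) (H : SimpleGraph V) : ℕ :=
  sInf (gallaiRamseySet k G H)

/-!
Let `N` belong to the Ramsey set for three colors. The product coloring of a cube of side `r - 1`
shows `(r - 1) ^ 3 < N`. Consider a coloring of `K_N` without a rainbow `P_5`. It has no rainbow
four-cycle either, because `N ≥ 6`. If some vertex meets four colors, or meets three colors while a
fourth one occurs elsewhere, then deleting at most three vertices leaves a monochromatic clique,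
which is large enough to contain `nK_r`. Otherwise at most three colors occur, or every vertex meets
at most two colors; in the latter case these sets of colors pairwise intersect, so they lie in a
set of three colors or share a color `c`.

In the last case every color other than `c` lives inside its own class of vertices. Choosing one
vertex from each of `r` classes gives a clique of color `c`, so fewer than `r` colors other than `c`
contain a `K_r` unless there is an `nK_r` of color `c`. Single out two of these colors, `a` and `b`.
If no color contains `nK_r`, the copies of `K_r` in the remaining ones are all hit by a set `J` of
at most `(r - 3)(n - 1)r ≤ (r - 1)(r - 2)²` vertices. Recoloring `J` by the product coloring of a
box with sides `r - 1`, `r - 2`, `r - 2` and merging all colors other than `c` and `b` into one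
gives a three-coloring without `nK_r`, a contradiction.

Conversely, `P_5` has four edges, so a coloring with three colors never contains a rainbow copy.
-/

section RainbowPaths

variable {V K : Type*} {e : V → V → K}

/-- The coloring `e`, a symmetric function whose diagonal is ignored, has no rainbow path on five
vertices. -/
def RainbowP5Free (e : V → V → K) : Prop :=
  ∀ ⦃a b c d f : V⦄, [a, b, c, d, f].Nodup → ¬ [e a b, e b c, e c d, e d f].Nodup

/-- A coloring has neither a rainbow path nor a rainbow cycle with four edges: the end `f` of the
walk may coincide with its start `a`. -/
def RainbowFourFree (e : V → V → K) : Prop :=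
  ∀ ⦃a b c d f : V⦄, [a, b, c, d].Nodup → f ∉ [b, c, d] → ¬ [e a b, e b c, e c d, e d f].Nodup

theorem RainbowP5Free.color_mem (h : RainbowP5Free e) {a b c d f : V}
    (hV : [a, b, c, d, f].Nodup) (hcol : [e a b, e b c, e c d].Nodup) :
    e d f ∈ [e a b, e b c, e c d] := by
  have := h hV
  grind

theorem RainbowP5Free.eq_of_rainbow_cycle (h : RainbowP5Free e) (hs : ∀ x y, e x y = e y x)
    {a b c d w : V} (hV : [a, b, c, d, w].Nodup) (hcol : [e a b, e b c, e c d, e d a].Nodup) :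
    e a w = e b c ∧ e c w = e a b ∨ e a w = e c d ∧ e c w = e d a := by
  have ha : e a w ∈ [e b c, e c d] := by
    have := h.color_mem (a := d) (b := c) (c := b) (d := a) (f := w)
    have := h.color_mem (a := b) (b := c) (c := d) (d := a) (f := w)
    grind
  have hc : e c w ∈ [e a b, e d a] := by
    have := h.color_mem (a := d) (b := a) (c := b) (d := c) (f := w)
    have := h.color_mem (a := b) (b := a) (c := d) (d := c) (f := w)
    grind
  have := @h b a w c d
  have := @h d a w c b
  grind

theorem RainbowP5Free.not_rainbow_cycle_of_eq_of_eq (h : RainbowP5Free e)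
    (hs : ∀ x y, e x y = e y x) {a b c d w w' : V} (hV : [a, b, c, d, w, w'].Nodup)
    (ha : e a w = e b c) (hd : e d w = e b c) : ¬ [e a b, e b c, e c d, e d a].Nodup := by
  intro hcol
  have hc : e c w = e a b := by
    have := h.eq_of_rainbow_cycle hs (a := a) (b := b) (c := c) (d := d) (w := w)
    grind
  have hww' : e w w' = e d a := by
    have := h.color_mem (a := c) (b := d) (c := a) (d := w) (f := w')
    have := h.color_mem (a := a) (b := d) (c := c) (d := w) (f := w')
    have := h.color_mem (a := b) (b := a) (c := d) (d := w) (f := w')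
    grind
  have := h.eq_of_rainbow_cycle hs (a := b) (b := c) (c := d) (d := a) (w := w')
  have := @h d w w' b a
  have := @h a w w' d c
  grind

theorem RainbowP5Free.not_rainbow_cycle (h : RainbowP5Free e) (hs : ∀ x y, e x y = e y x)
    {a b c d w w' : V} (hV : [a, b, c, d, w, w'].Nodup) :
    ¬ [e a b, e b c, e c d, e d a].Nodup := by
  intro hcol
  have := h.eq_of_rainbow_cycle hs (a := a) (b := b) (c := c) (d := d) (w := w)
  have := h.eq_of_rainbow_cycle hs (a := b) (b := c) (c := d) (d := a) (w := w)
  have := h.not_rainbow_cycle_of_eq_of_eq hs (a := a) (b := b) (c := c) (d := d) (w := w) (w' := w')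
  have := h.not_rainbow_cycle_of_eq_of_eq hs (a := b) (b := c) (c := d) (d := a) (w := w) (w' := w')
  have := h.not_rainbow_cycle_of_eq_of_eq hs (a := c) (b := d) (c := a) (d := b) (w := w) (w' := w')
  have := h.not_rainbow_cycle_of_eq_of_eq hs (a := d) (b := a) (c := b) (d := c) (w := w) (w' := w')
  grind

theorem exists_notMem_of_card_lt [Fintype V] {S : Finset V} (hS : S.card < Fintype.card V) :
    ∃ x, x ∉ S := by
  simpa using Finset.exists_mem_notMem_of_card_lt_card (hS.trans_eq Finset.card_univ.symm)

theorem RainbowP5Free.rainbowFourFree [Fintype V] (h : RainbowP5Free e)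
    (hs : ∀ x y, e x y = e y x) (hV : 6 ≤ Fintype.card V) : RainbowFourFree e := by
  classical
  intro a b c d f habcd hf hcol
  rcases eq_or_ne f a with rfl | hfa
  · obtain ⟨w, hw⟩ := exists_notMem_of_card_lt
      (S := {f, b, c, d}) (Finset.card_le_four.trans_lt (by omega))
    obtain ⟨w', hw'⟩ := exists_notMem_of_card_lt
      (S := {f, b, c, d, w}) (Finset.card_le_five.trans_lt (by omega))
    exact h.not_rainbow_cycle hs (w := w) (w' := w') (by grind) hcol
  · exact h (by grind) hcol

end RainbowPaths

namespace RainbowFourFree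

variable {V K : Type*} {e : V → V → K}

theorem color_mem (h : RainbowFourFree e) {a b c d f : V} (hV : [a, b, c, d].Nodup)
    (hf : f ∉ [b, c, d]) (hcol : [e a b, e b c, e c d].Nodup) : e d f ∈ [e a b, e b c, e c d] := by
  have := h hV hf
  grind

theorem color_mem_pair (h : RainbowFourFree e) (hs : ∀ x y, e x y = e y x) {v y u u' z w : V}
    (hV : [v, y, u, u', z].Nodup) (hcol : [e v y, e v u, e v u', e y z].Nodup) (hwv : w ≠ v)
    (hwz : w ≠ z) : e z w ∈ [e v y, e y z] := by
  have := h.color_mem (a := u) (b := v) (c := y) (d := z) (f := w)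
  have := h.color_mem (a := u') (b := v) (c := y) (d := z) (f := w)
  grind

theorem color_eq (h : RainbowFourFree e) (hs : ∀ x y, e x y = e y x) {v y u u' z : V}
    (hV : [v, y, u, u', z].Nodup) (hcol : [e v y, e v u, e v u', e y z].Nodup) :
    ∀ w, w ≠ v → w ≠ z → e z w = e y z := by
  have hu : e z u = e y z := by
    have := h.color_mem_pair hs hV hcol (w := u)
    have := @h u' v u z y
    grind
  intro w hwv hwz
  have hy := h.color_mem_pair hs hV hcol hwv hwz
  have := h.color_mem_pair hs (v := v) (y := u) (u := y) (u' := u') (z := z) (w := w)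
  grind

theorem exists_color_ne (h : RainbowFourFree e) (hs : ∀ x y, e x y = e y x) {v z u₁ u₂ u₃ : V}
    (hV : [v, z, u₁, u₂, u₃].Nodup) (hcol : [e v z, e v u₁, e v u₂, e v u₃].Nodup) :
    ∃ u ∈ [u₁, u₂, u₃], e z u ≠ e v u := by
  by_contra! hz
  have h23 : e u₂ u₃ = e v z := by
    have := @h u₂ v z u₃ u₂
    have := @h u₁ v z u₃ u₂
    have := @h u₃ v z u₂ u₃
    have := @h u₁ v z u₂ u₃
    grind
  have := @h u₁ v u₂ u₃ z
  grind

end RainbowFourFree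

section Stars

variable {V K : Type*} {e : V → V → K} {v : V}

/-- The edges from `v` to the vertices in `R` have pairwise different colors. -/
def IsRainbowStar (e : V → V → K) (v : V) (R : Finset V) : Prop :=
  v ∉ R ∧ Set.InjOn (e v) R

/-- The set of colors of the edges at `v`. -/
def colorsAt [Fintype V] [DecidableEq V] [DecidableEq K] (e : V → V → K) (v : V) : Finset K :=
  (Finset.univ.erase v).image (e v)

theorem mem_colorsAt [Fintype V] [DecidableEq V] [DecidableEq K] {w : V} (hw : w ≠ v) :
    e v w ∈ colorsAt e v :=
  Finset.mem_image_of_mem _ (by simpa using hw)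

theorem exists_isRainbowStar_card_eq [Fintype V] [DecidableEq V] [DecidableEq K] {m : ℕ}
    (hm : m ≤ (colorsAt e v).card) : ∃ R, IsRainbowStar e v R ∧ R.card = m := by
  obtain ⟨C, hC, rfl⟩ := Finset.exists_subset_card_eq hm
  have hsurj : Set.SurjOn (e v) ↑(Finset.univ.erase v) ↑C := by
    rw [Set.SurjOn, ← Finset.coe_image]
    exact_mod_cast hC
  obtain ⟨R, hR, hinj, himg⟩ := Finset.exists_subset_injOn_image_eq_of_surjOn _ _ hsurj
  exact ⟨R, ⟨fun hv => by simpa using hR hv, hinj⟩, by rw [← himg, Finset.card_image_of_injOn hinj]⟩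

theorem IsRainbowStar.card_le_card_filter_add [DecidableEq K] {R : Finset V}
    (hR : IsRainbowStar e v R) (A : Finset K) :
    R.card ≤ (R.filter fun u => e v u ∉ A).card + A.card := by
  rw [← Finset.card_filter_add_card_filter_not (s := R) (fun u => e v u ∉ A)]
  gcongr
  exact Finset.card_le_card_of_injOn (e v) (fun u hu => by simpa using (Finset.mem_filter.mp hu).2)
    (hR.2.mono fun u hu => (Finset.mem_filter.mp hu).1)

theorem IsRainbowStar.insert_erase [DecidableEq V] {R : Finset V} (hR : IsRainbowStar e v R)
    (hRne : R.Nonempty) {z : V} (hzv : z ≠ v) :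
    ∃ u ∈ R, IsRainbowStar e v (insert z (R.erase u)) := by
  obtain ⟨u, huR, hu⟩ : ∃ u ∈ R, ∀ u' ∈ R, e v u' = e v z → u' = u := by
    by_cases h : ∃ u ∈ R, e v u = e v z
    · obtain ⟨u, huR, hu⟩ := h
      exact ⟨u, huR, fun u' hu' heq => hR.2 hu' huR (heq.trans hu.symm)⟩
    · obtain ⟨u, huR⟩ := hRne
      exact ⟨u, huR, fun u' hu' heq => absurd ⟨u', hu', heq⟩ h⟩
  refine ⟨u, huR, ?_, ?_⟩
  · have := hR.1
    grind
  · have := hR.2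
    simp only [Set.InjOn, Finset.mem_coe] at *
    grind

end Stars

section NearlyMonochromatic

variable {V K : Type*} {e : V → V → K} {v : V}

/-- All edges avoiding some set of at most three vertices have the same color. -/
def IsNearlyMonochromatic (e : V → V → K) : Prop :=
  ∃ S : Finset V, S.card ≤ 3 ∧ ∃ c, ∀ x ∉ S, ∀ y ∉ S, x ≠ y → e x y = c

theorem isNearlyMonochromatic_of_forall_notMem (hs : ∀ x y, e x y = e y x) {S : Finset V}
    (hS : S.card ≤ 3) (hv : v ∈ S) {t : V} {c : K}
    (hc : ∀ x ∉ S, x ≠ t → ∀ w, w ≠ v → w ≠ x → e x w = c) : IsNearlyMonochromatic e := by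
  refine ⟨S, hS, c, fun x hx y hy hxy => ?_⟩
  by_cases hxt : x = t
  · rw [hs]
    exact hc y hy (by grind) x (by grind) hxy
  · exact hc x hx hxt y (by grind) hxy.symm

namespace RainbowFourFree

theorem exists_color_eq_of_isRainbowStar (h : RainbowFourFree e) (hs : ∀ x y, e x y = e y x)
    {R : Finset V} (hR : IsRainbowStar e v R) (hcard : 4 ≤ R.card) {z : V} (hzv : z ≠ v)
    (hzR : z ∉ R) : ∃ c, ∀ w, w ≠ v → w ≠ z → e z w = c := by
  classical
  have hinj : ∀ ⦃x⦄, x ∈ R → ∀ ⦃y⦄, y ∈ R → e v x = e v y → x = y := hR.2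
  have : v ∉ R := hR.1
  obtain ⟨y, hyR, hy⟩ : ∃ y ∈ R, e z y ≠ e v y := by
    have := hR.card_le_card_filter_add {e v z}
    obtain ⟨u₁, u₂, u₃, h₁, h₂, h₃, h₁₂, h₁₃, h₂₃⟩ := Finset.two_lt_card_iff.mp
      (show 2 < (R.filter fun u => e v u ∉ ({e v z} : Finset K)).card by
        rw [Finset.card_singleton] at this; omega)
    rw [Finset.mem_filter, Finset.mem_singleton] at h₁ h₂ h₃
    obtain ⟨u, hu, hne⟩ := h.exists_color_ne hs (v := v) (z := z) (u₁ := u₁) (u₂ := u₂)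
      (u₃ := u₃) (by grind) (by grind)
    exact ⟨u, by grind, hne⟩
  have := hR.card_le_card_filter_add {e v y, e y z}
  have := Finset.card_le_two (a := e v y) (b := e y z)
  obtain ⟨u, hu, u', hu', huu'⟩ := Finset.one_lt_card.mp
    (show 1 < (R.filter fun u => e v u ∉ ({e v y, e y z} : Finset K)).card by omega)
  simp only [Finset.mem_filter, Finset.mem_insert, Finset.mem_singleton, not_or] at hu hu'
  exact ⟨_, h.color_eq hs (v := v) (y := y) (u := u) (u' := u') (by grind) (by grind)⟩

theorem isNearlyMonochromatic_of_isRainbowStar [Fintype V] (h : RainbowFourFree e)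
    (hs : ∀ x y, e x y = e y x) (hV : 6 ≤ Fintype.card V) {R : Finset V}
    (hR : IsRainbowStar e v R) (hcard : R.card = 4) : IsNearlyMonochromatic e := by
  classical
  obtain ⟨z, hz⟩ := exists_notMem_of_card_lt (S := insert v R)
    ((Finset.card_insert_le v R).trans_lt (by omega))
  rw [Finset.mem_insert, not_or] at hz
  obtain ⟨u, huR, hu⟩ := hR.insert_erase (Finset.card_pos.mp (by omega)) hz.1
  have : v ∉ R := hR.1
  have hcard' : (R.erase u).card = 3 := by rw [Finset.card_erase_of_mem huR, hcard]
  have hconst : ∀ x, x ≠ v → x ∉ R.erase u → ∃ c, ∀ w, w ≠ v → w ≠ x → e x w = c := by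
    intro x hxv hx
    by_cases hxR : x ∈ R
    · refine h.exists_color_eq_of_isRainbowStar hs hu ?_ hxv (by grind)
      rw [Finset.card_insert_of_notMem (by grind), hcard']
    · exact h.exists_color_eq_of_isRainbowStar hs hR hcard.ge hxv hxR
  obtain ⟨c, hc⟩ := hconst z hz.1 (by grind)
  obtain ⟨t, ht⟩ : (R.erase u).Nonempty := Finset.card_pos.mp (by omega)
  refine isNearlyMonochromatic_of_forall_notMem hs (S := insert v ((R.erase u).erase t)) (t := t)
    (c := c) ?_ (Finset.mem_insert_self _ _) fun x hx hxt w hwv hwx => ?_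
  · have := Finset.card_insert_le v ((R.erase u).erase t)
    rw [Finset.card_erase_of_mem ht] at this
    omega
  · obtain ⟨d, hd⟩ := hconst x (by grind) (by grind)
    rcases eq_or_ne x z with rfl | hxz
    · exact hc w hwv hwx
    · rw [hd w hwv hwx, ← hd z hz.1 hxz.symm, hs, hc x (by grind) hxz]

theorem isNearlyMonochromatic_of_color_eq (h : RainbowFourFree e) (hs : ∀ x y, e x y = e y x)
    {p q u u' : V} (hV : [v, p, q, u, u'].Nodup) (hpq : e v p = e v q)
    (hcol : [e v p, e v u, e v u', e p q].Nodup) : IsNearlyMonochromatic e := by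
  classical
  have hp := h.color_eq hs (v := v) (y := q) (u := u) (u' := u') (z := p) (by grind) (by grind)
  refine isNearlyMonochromatic_of_forall_notMem hs (S := {v, u}) (t := u') (c := e p q)
    (Finset.card_le_two.trans (by norm_num)) (Finset.mem_insert_self _ _)
    fun x hx hxt w hwv hwx => ?_
  rcases eq_or_ne x p with rfl | hxp
  · exact (hp w hwv hwx).trans (hs q x)
  · have hpx : e p x = e p q := (hp x (by grind) hxp).trans (hs q p)
    rw [← hpx]
    exact h.color_eq hs (v := v) (y := p) (u := u) (u' := u') (by grind) (by grind) w hwv hwx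

theorem isNearlyMonochromatic_of_color_ne (h : RainbowFourFree e) (hs : ∀ x y, e x y = e y x)
    {p q x : V} (hV : [v, p, q, x].Nodup) (hcol : [e v p, e v q, e v x, e p q].Nodup)
    (hall : ∀ w, w ≠ v → e v w ∈ [e v p, e v q, e v x]) : IsNearlyMonochromatic e := by
  classical
  by_cases hp : ∃ p', p' ≠ v ∧ p' ≠ p ∧ e v p' = e v p
  · obtain ⟨p', hp'v, hp'p, hp'⟩ := hp
    have := h.color_eq hs (v := v) (y := q) (u := p') (u' := x) (z := p) (by grind) (by grind)
    exact h.isNearlyMonochromatic_of_color_eq hs (v := v) (p := p) (q := p') (u := q) (u' := x)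
      (by grind) hp'.symm (by grind)
  by_cases hq : ∃ q', q' ≠ v ∧ q' ≠ q ∧ e v q' = e v q
  · obtain ⟨q', hq'v, hq'q, hq'⟩ := hq
    have := h.color_eq hs (v := v) (y := p) (u := q') (u' := x) (z := q) (by grind) (by grind)
    exact h.isNearlyMonochromatic_of_color_eq hs (v := v) (p := q) (q := q') (u := p) (u' := x)
      (by grind) hq'.symm (by grind)
  have hvx : ∀ w, w ≠ v → w ∉ [p, q] → e v w = e v x := by grind
  by_cases hyz : ∃ y z, [v, p, q, y, z].Nodup ∧ e y z = e p q
  · obtain ⟨y, z, hV', hyz⟩ := hyz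
    exact h.isNearlyMonochromatic_of_color_eq hs (v := v) (p := y) (q := z) (u := p) (u' := q)
      (by grind) (by grind) (by grind)
  refine ⟨{p, q}, Finset.card_le_two.trans (by norm_num), e v x, fun y hy z hz hne => ?_⟩
  rcases eq_or_ne y v with rfl | hyv
  · exact hvx z hne.symm (by simpa using hz)
  rcases eq_or_ne z v with rfl | hzv
  · exact (hs y z).trans (hvx y hne (by simpa using hy))
  have hvy : e v y = e v x := hvx y hyv (by simpa using hy)
  have hne' : e y z ≠ e p q := fun heq => hyz ⟨y, z, by grind, heq⟩
  have := h.color_mem (a := q) (b := p) (c := v) (d := y) (f := z)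
  have := h.color_mem (a := p) (b := q) (c := v) (d := y) (f := z)
  grind

theorem isNearlyMonochromatic_of_notMem_colorsAt [Fintype V] [DecidableEq V] [DecidableEq K]
    (h : RainbowFourFree e) (hs : ∀ x y, e x y = e y x) (hcard : (colorsAt e v).card = 3)
    {p q : V} (hpq : p ≠ q) (hne : e p q ∉ colorsAt e v) : IsNearlyMonochromatic e := by
  have hpv : p ≠ v := by rintro rfl; exact hne (mem_colorsAt hpq.symm)
  have hqv : q ≠ v := by rintro rfl; exact hne (hs p q ▸ mem_colorsAt hpq)
  obtain ⟨R, hR, hRcard⟩ := exists_isRainbowStar_card_eq hcard.ge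
  have hcol : ∀ w, w ≠ v → e v w ≠ e p q := fun w hw heq => hne (heq ▸ mem_colorsAt hw)
  have : v ∉ R := hR.1
  by_cases heq : e v p = e v q
  · have := hR.card_le_card_filter_add {e v p}
    obtain ⟨u, hu, u', hu', huu'⟩ := Finset.one_lt_card.mp
      (show 1 < (R.filter fun u => e v u ∉ ({e v p} : Finset K)).card by
        rw [Finset.card_singleton] at this; omega)
    rw [Finset.mem_filter, Finset.mem_singleton] at hu hu'
    have := hR.2.ne hu.1 hu'.1 huu'
    exact h.isNearlyMonochromatic_of_color_eq hs (v := v) (p := p) (q := q) (u := u) (u' := u')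
      (by grind) heq (by grind)
  · have := hR.card_le_card_filter_add {e v p, e v q}
    rw [Finset.card_pair heq] at this
    obtain ⟨x, hx⟩ := Finset.card_pos.mp
      (show 0 < (R.filter fun u => e v u ∉ ({e v p, e v q} : Finset K)).card by omega)
    simp only [Finset.mem_filter, Finset.mem_insert, Finset.mem_singleton, not_or] at hx
    have hxv : x ≠ v := by grind
    have hall : {e v p, e v q, e v x} = colorsAt e v := by
      refine Finset.eq_of_subset_of_card_le ?_ ?_
      · simp [Finset.insert_subset_iff, mem_colorsAt, hpv, hqv, hxv]
      · rw [hcard, Finset.card_eq_three.mpr ⟨_, _, _, heq, Ne.symm hx.2.1, Ne.symm hx.2.2, rfl⟩]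
    refine h.isNearlyMonochromatic_of_color_ne hs (v := v) (p := p) (q := q) (x := x)
      (by grind) (by grind) fun w hw => ?_
    have := hall ▸ mem_colorsAt (e := e) hw
    simpa using this

end RainbowFourFree

end NearlyMonochromatic

section Structure

variable {V K : Type*} {e : V → V → K}

theorem exists_eq_pair_of_card_le_two [DecidableEq K] {s : Finset K} (hs : s.Nonempty)
    (hcard : s.card ≤ 2) : ∃ a b, s = {a, b} := by
  obtain ⟨a, ha⟩ := hs
  by_cases hsa : s ⊆ {a}
  · exact ⟨a, a, by grind⟩
  · obtain ⟨b, hb, hba⟩ := Finset.not_subset.mp hsa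
    refine ⟨a, b, (Finset.eq_of_subset_of_card_le (by grind) ?_).symm⟩
    rwa [Finset.card_pair (by grind)]

theorem exists_common_mem_or_subset_of_not_disjoint {ι : Type*} (A : ι → Finset K)
    (hA : ∀ i, (A i).card ≤ 2) (hdisj : ∀ i j, ¬ Disjoint (A i) (A j)) :
    (∃ c, ∀ i, c ∈ A i) ∨ ∃ T : Finset K, T.card ≤ 3 ∧ ∀ i, A i ⊆ T := by
  classical
  rcases isEmpty_or_nonempty ι with _ | ⟨⟨i⟩⟩
  · exact .inr ⟨∅, by simp, isEmptyElim⟩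
  have hne : ∀ i, (A i).Nonempty := fun i => by
    simpa [Finset.nonempty_iff_ne_empty] using hdisj i i
  choose a b hab using fun i => exists_eq_pair_of_card_le_two (hne i) (hA i)
  simp only [hab, Finset.not_disjoint_iff] at hdisj ⊢
  by_cases hai : ∃ j, a i ∉ ({a j, b j} : Finset K)
  · by_cases hbi : ∃ k, b i ∉ ({a k, b k} : Finset K)
    · obtain ⟨j, hj⟩ := hai
      obtain ⟨k, hk⟩ := hbi
      obtain ⟨c, hcj, hck⟩ := hdisj j k
      have hA' : ∀ l, A l ⊆ {a i, b i, c} := by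
        intro l
        have := hdisj i j
        have := hdisj i k
        have := hdisj i l
        have := hdisj j l
        have := hdisj k l
        grind
      exact .inr ⟨{a i, b i, c}, Finset.card_le_three, fun l => hab l ▸ hA' l⟩
    · exact .inl ⟨b i, not_exists_not.mp hbi⟩
  · exact .inl ⟨a i, not_exists_not.mp hai⟩

/-- Every edge `xy` has either the color `c` or the color `g x = g y`. -/
def IsDominant (e : V → V → K) (c : K) (g : V → K) : Prop :=
  ∀ x y, x ≠ y → e x y = c ∨ e x y = g x ∧ g x = g y

theorem exists_isDominant [Fintype V] [DecidableEq V] [DecidableEq K]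
    (hs : ∀ x y, e x y = e y x) {c : K} (hc : ∀ v, c ∈ colorsAt e v)
    (hcard : ∀ v, (colorsAt e v).card ≤ 2) : ∃ g, IsDominant e c g := by
  have hpair : ∀ v, ∃ d, colorsAt e v ⊆ {c, d} := by
    intro v
    obtain ⟨a, b, hab⟩ := exists_eq_pair_of_card_le_two ⟨c, hc v⟩ (hcard v)
    have := hc v
    rcases eq_or_ne c a with rfl | hca
    · exact ⟨b, hab.subset⟩
    · exact ⟨a, by grind⟩
  choose g hg using hpair
  refine ⟨g, fun x y hxy => ?_⟩
  have hx := hg x (mem_colorsAt hxy.symm)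
  have hy := hg y (mem_colorsAt hxy)
  rw [Finset.mem_insert, Finset.mem_singleton] at hx hy
  grind

theorem RainbowFourFree.trichotomy [Fintype V] (h : RainbowFourFree e)
    (hs : ∀ x y, e x y = e y x) (hV : 6 ≤ Fintype.card V) :
    (∃ T : Finset K, T.card ≤ 3 ∧ ∀ x y, x ≠ y → e x y ∈ T) ∨ (∃ c g, IsDominant e c g) ∨
      IsNearlyMonochromatic e := by
  classical
  by_cases h4 : ∃ v, 4 ≤ (colorsAt e v).card
  · obtain ⟨v, hv⟩ := h4
    obtain ⟨R, hR, hcard⟩ := exists_isRainbowStar_card_eq hv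
    exact .inr (.inr (h.isNearlyMonochromatic_of_isRainbowStar hs hV hR hcard))
  by_cases h3 : ∃ v, (colorsAt e v).card = 3
  · obtain ⟨v, hv⟩ := h3
    by_cases hall : ∀ x y, x ≠ y → e x y ∈ colorsAt e v
    · exact .inl ⟨_, hv.le, hall⟩
    · push Not at hall
      obtain ⟨p, q, hpq, hne⟩ := hall
      exact .inr (.inr (h.isNearlyMonochromatic_of_notMem_colorsAt hs hv hpq hne))
  have h2 : ∀ v, (colorsAt e v).card ≤ 2 := by grind
  have hdisj : ∀ x y, ¬ Disjoint (colorsAt e x) (colorsAt e y) := by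
    intro x y
    rw [Finset.not_disjoint_iff]
    rcases eq_or_ne x y with rfl | hxy
    · obtain ⟨w, hw⟩ := Fintype.exists_ne_of_one_lt_card (by omega) x
      exact ⟨e x w, mem_colorsAt hw, mem_colorsAt hw⟩
    · exact ⟨e x y, mem_colorsAt hxy.symm, hs x y ▸ mem_colorsAt hxy⟩
  rcases exists_common_mem_or_subset_of_not_disjoint (colorsAt e) h2 hdisj with
    ⟨c, hc⟩ | ⟨T, hT, hsub⟩
  · exact .inr (.inl ⟨c, exists_isDominant hs hc h2⟩)
  · exact .inl ⟨T, hT, fun x y hxy => hsub x (mem_colorsAt hxy.symm)⟩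

end Structure

section Cliques

variable {V K : Type*} {e : V → V → K} {c : K}

/-- All edges inside `s` have the color `c`. -/
def IsMonoClique (e : V → V → K) (c : K) (s : Finset V) : Prop :=
  (s : Set V).Pairwise fun x y => e x y = c

/-- There are `n` pairwise disjoint cliques of color `c` with `r` vertices each. -/
def HasDisjointCliques (e : V → V → K) (c : K) (n r : ℕ) : Prop :=
  ∃ s : Fin n → Finset V, (∀ i, (s i).card = r ∧ IsMonoClique e c (s i)) ∧
    Pairwise fun i j => Disjoint (s i) (s j)

theorem IsMonoClique.exists_color_eq {s : Finset V} (h : IsMonoClique e c s) (hs : 2 ≤ s.card) :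
    ∃ x ∈ s, ∃ y ∈ s, x ≠ y ∧ e x y = c := by
  obtain ⟨x, hx, y, hy, hxy⟩ := Finset.one_lt_card.mp hs
  exact ⟨x, hx, y, hy, hxy, h hx hy hxy⟩

theorem IsMonoClique.insert [DecidableEq V] (hs : ∀ x y, e x y = e y x) {s : Finset V}
    (h : IsMonoClique e c s) {v : V} (hv : ∀ x ∈ s, e v x = c) :
    IsMonoClique e c (insert v s) := by
  rw [IsMonoClique, Finset.coe_insert]
  exact Set.Pairwise.insert h fun x hx _ => ⟨hv x hx, (hs x v).trans (hv x hx)⟩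

theorem HasDisjointCliques.of_injective {n r : ℕ} (f : Fin n × Fin r → V)
    (hf : Function.Injective f) (hc : ∀ i a b, a ≠ b → e (f (i, a)) (f (i, b)) = c) :
    HasDisjointCliques e c n r := by
  have hfi : ∀ i, Function.Injective fun a => f (i, a) := fun i a b hab => by simpa using hf hab
  refine ⟨fun i => Finset.univ.map ⟨fun a => f (i, a), hfi i⟩, fun i => ⟨by simp, ?_⟩,
    fun i j hij => ?_⟩
  · simp only [IsMonoClique, Set.Pairwise, Finset.coe_map, Function.Embedding.coeFn_mk,
      Finset.coe_univ, Set.image_univ, Set.forall_mem_range]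
    exact fun a b hab => hc i a b fun h => hab (by rw [h])
  · simp only [Finset.disjoint_left, Finset.mem_map, Finset.mem_univ, true_and,
      Function.Embedding.coeFn_mk, not_exists, forall_exists_index, forall_apply_eq_imp_iff]
    exact fun a b hab => hij (congrArg Prod.fst (hf hab)).symm

theorem IsMonoClique.hasDisjointCliques {s : Finset V} (h : IsMonoClique e c s) {n r : ℕ}
    (hs : n * r ≤ s.card) : HasDisjointCliques e c n r := by
  obtain ⟨f⟩ : Nonempty (Fin n × Fin r ↪ s) :=
    Function.Embedding.nonempty_of_card_le (by simpa using hs)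
  refine .of_injective (fun p => (f p : V)) (Subtype.val_injective.comp f.injective) ?_
  exact fun i a b hab => h (f _).2 (f _).2 (by simpa [Subtype.val_inj] using hab)

theorem HasDisjointCliques.exists_injective {n r : ℕ} (h : HasDisjointCliques e c n r) :
    ∃ f : Fin n × Fin r → V, Function.Injective f ∧
      ∀ i a b, a ≠ b → e (f (i, a)) (f (i, b)) = c := by
  obtain ⟨s, hs, hdisj⟩ := h
  let φ i : Fin r ≃ s i := ((s i).equivFinOfCardEq (hs i).1).symm
  have hφ : ∀ i, Function.Injective fun a => (φ i a : V) := fun i =>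
    Subtype.val_injective.comp (φ i).injective
  refine ⟨fun p => φ p.1 p.2, ?_, fun i a b hab => (hs i).2 (φ i a).2 (φ i b).2 ((hφ i).ne hab)⟩
  rintro ⟨i, a⟩ ⟨j, b⟩ (heq : (φ i a : V) = φ j b)
  obtain rfl : i = j := by
    by_contra hij
    exact Finset.disjoint_left.mp (hdisj hij) (φ i a).2 (heq ▸ (φ j b).2)
  rw [hφ i heq]

theorem hasMonochromaticCopy_disjointCopies_iff {C : TopEdgeLabeling V K} {n r : ℕ}
    (hC : ∀ x y (h : x ≠ y), C.get x y h = e x y) :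
    HasMonochromaticCopy C (disjointCopies n (completeGraph (Fin r))) ↔
      ∃ c, HasDisjointCliques e c n r := by
  refine exists_congr fun c => ⟨fun ⟨f⟩ => ?_, fun h => ?_⟩
  · refine .of_injective f f.injective fun i a b hab => ?_
    have hadj : (C.labelGraph c).Adj (f (i, a)) (f (i, b)) := f.toHom.map_adj ⟨rfl, hab⟩
    obtain ⟨hne, hcol⟩ := (TopEdgeLabeling.labelGraph_adj ..).mp hadj
    exact (hC _ _ hne).symm.trans hcol
  · obtain ⟨f, hf, hcol⟩ := h.exists_injective
    refine ⟨⟨⟨f, ?_⟩, hf⟩⟩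
    rintro ⟨i, a⟩ ⟨j, b⟩ ⟨rfl : i = j, hab : a ≠ b⟩
    have hne : f (i, a) ≠ f (i, b) := hf.ne (by simpa using hab)
    exact (TopEdgeLabeling.labelGraph_adj ..).mpr ⟨hne, (hC _ _ hne).trans (hcol i a b hab)⟩

theorem HasDisjointCliques.imp {K' : Type*} {e' : V → V → K'} {c' : K'} {n r : ℕ}
    (h : HasDisjointCliques e' c' n r)
    (hc : ∀ s : Finset V, s.card = r → IsMonoClique e' c' s → IsMonoClique e c s) :
    HasDisjointCliques e c n r :=
  let ⟨s, hs, hdisj⟩ := h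
  ⟨s, fun i => ⟨(hs i).1, hc _ (hs i).1 (hs i).2⟩, hdisj⟩

theorem exists_hasDisjointCliques_of_comp {K' : Type*} {T : Set K} {φ : K → K'}
    (hφ : Set.InjOn φ T) (hT : ∀ x y, x ≠ y → e x y ∈ T) {n r : ℕ} (hn : 1 ≤ n) (hr : 2 ≤ r)
    {c' : K'} (h : HasDisjointCliques (fun x y => φ (e x y)) c' n r) :
    ∃ c, HasDisjointCliques e c n r := by
  obtain ⟨s, hs, -⟩ := id h
  obtain ⟨x, -, y, -, hxy, rfl⟩ := (hs ⟨0, hn⟩).2.exists_color_eq (hr.trans (hs _).1.ge)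
  exact ⟨e x y, h.imp fun t _ ht z hz w hw hzw =>
    hφ (hT z w hzw) (hT x y hxy) (ht hz hw hzw)⟩

theorem hasDisjointCliques_or_exists_hitting_set (e : V → V → K) (c : K) (n r : ℕ) :
    HasDisjointCliques e c n r ∨ ∃ U : Finset V, U.card ≤ (n - 1) * r ∧
      ∀ s : Finset V, s.card = r → IsMonoClique e c s → ¬ Disjoint s U := by
  classical
  induction n with
  | zero => exact .inl ⟨fun _ => ∅, fun i => i.elim0, fun i => i.elim0⟩
  | succ n ih =>
    obtain ⟨s, hs, hdisj⟩ | ⟨U, hU, hit⟩ := ih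
    · by_cases hit : ∃ t : Finset V, t.card = r ∧ IsMonoClique e c t ∧
          Disjoint t (Finset.univ.biUnion s)
      · obtain ⟨t, ht, hmono, hdt⟩ := hit
        simp only [Finset.disjoint_biUnion_right, Finset.mem_univ, forall_const] at hdt
        refine .inl ⟨Fin.cons t s, Fin.cases ⟨ht, hmono⟩ hs, ?_⟩
        refine Fin.cases (Fin.cases (fun h => absurd rfl h) fun j _ => by simpa using hdt j) ?_
        exact fun i => Fin.cases (fun _ => by simpa using (hdt i).symm) fun j hij => by
          simpa using hdisj (ne_of_apply_ne Fin.succ hij)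
      · push Not at hit
        refine .inr ⟨Finset.univ.biUnion s, ?_, hit⟩
        simpa using Finset.card_biUnion_le_card_mul Finset.univ s r fun i _ => (hs i).1.le
    · exact .inr ⟨U, hU.trans (Nat.mul_le_mul_right _ (by omega)), hit⟩

end Cliques

section Ramsey

universe u

theorem exists_card_le_card_filter_eq {V K : Type*} [Fintype K] [Nonempty K] [DecidableEq K]
    (f : V → K) (S : Finset V) {N : K → ℕ} (hN : ∑ c, N c ≤ S.card) :
    ∃ c, N c ≤ (S.filter fun x => f x = c).card := by
  rw [Finset.card_eq_sum_card_fiberwise (f := f) (t := Finset.univ) (by simp)] at hN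
  obtain ⟨c, -, hc⟩ := Finset.exists_le_of_sum_le Finset.univ_nonempty hN
  exact ⟨c, hc⟩

theorem sum_update_pred_lt {K : Type*} [Fintype K] [DecidableEq K] {t : K → ℕ} {c : K}
    (hc : t c ≠ 0) : ∑ d, Function.update t c (t c - 1) d < ∑ d, t d := by
  refine Finset.sum_lt_sum (fun d _ => ?_) ⟨c, Finset.mem_univ c, by simpa using hc.bot_lt⟩
  rw [Function.update_apply]
  grind

theorem exists_isMonoClique_of_card_le {K : Type*} [Finite K] [Nonempty K] (t : K → ℕ) :
    ∃ N : ℕ, ∀ (V : Type u) (e : V → V → K), (∀ x y, e x y = e y x) →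
      ∀ S : Finset V, N ≤ S.card → ∃ c, ∃ s ⊆ S, s.card = t c ∧ IsMonoClique e c s := by
  classical
  have := Fintype.ofFinite K
  induction hm : ∑ c, t c using Nat.strong_induction_on generalizing t with
  | _ m ih =>
  by_cases h0 : ∃ c, t c = 0
  · obtain ⟨c, hc⟩ := h0
    exact ⟨0, fun V e _ S _ => ⟨c, ∅, by simp [hc, IsMonoClique]⟩⟩
  push Not at h0
  choose N hN using fun c => ih _ (hm ▸ sum_update_pred_lt (h0 c)) _ rfl
  refine ⟨∑ c, N c + 1, fun V e hs S hS => ?_⟩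
  obtain ⟨v, hv⟩ : S.Nonempty := Finset.card_pos.mp (by omega)
  obtain ⟨c, hc⟩ := exists_card_le_card_filter_eq (e v) (S.erase v) (N := N)
    (by rw [Finset.card_erase_of_mem hv]; omega)
  obtain ⟨d, s, hsub, hcard, hmono⟩ := hN c V e hs _ hc
  simp only [Finset.subset_iff, Finset.mem_filter, Finset.mem_erase] at hsub
  by_cases hdc : d = c
  · subst hdc
    refine ⟨d, insert v s, by grind, ?_, hmono.insert hs fun x hx => (hsub hx).2⟩
    have := h0 d
    rw [Finset.card_insert_of_notMem fun h => (hsub h).1.1 rfl, hcard, Function.update_self]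
    omega
  · exact ⟨d, s, by grind, by rw [hcard, Function.update_of_ne hdc], hmono⟩

end Ramsey

section ProductColoring

variable {V ι : Type*} [Nonempty ι]

/-- A coordinate in which the images of `x` and `y` under `h` differ, chosen independently of the
order of `x` and `y` (and arbitrary if `h x = h y`). -/
noncomputable def diffCoord (h : V → ι → ℕ) (x y : V) : ι :=
  Classical.epsilon fun i => h x i ≠ h y i

theorem diffCoord_comm (h : V → ι → ℕ) (x y : V) : diffCoord h x y = diffCoord h y x := by
  simp only [diffCoord, ne_comm]

theorem IsMonoClique.card_le_of_diffCoord {h : V → ι → ℕ} {i : ι} {s : Finset V}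
    (hs : IsMonoClique (diffCoord h) i s) (hinj : Set.InjOn h s) {m : ℕ}
    (hm : ∀ x ∈ s, h x i < m) : s.card ≤ m := by
  rw [← Finset.card_range m]
  refine Finset.card_le_card_of_injOn (h · i) (fun x hx => by simpa using hm x hx) ?_
  intro x hx y hy hxy
  by_contra hne
  have hdiff : h x (diffCoord h x y) ≠ h y (diffCoord h x y) :=
    Classical.epsilon_spec (Function.ne_iff.mp (hinj.ne hx hy hne))
  rw [hs hx hy hne] at hdiff
  exact hdiff hxy

theorem exists_coloring_card_le_of_isMonoClique [Fintype ι] (J : Finset V) (m : ι → ℕ)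
    (hJ : J.card ≤ ∏ i, m i) : ∃ χ : V → V → ι, (∀ x y, χ x y = χ y x) ∧
      ∀ i, ∀ t ⊆ J, IsMonoClique χ i t → t.card ≤ m i := by
  classical
  obtain ⟨f⟩ : Nonempty (J ↪ ∀ i, Fin (m i)) :=
    Function.Embedding.nonempty_of_card_le (by simpa using hJ)
  let h : V → ι → ℕ := fun x i => if hx : x ∈ J then f ⟨x, hx⟩ i else 0
  have hval : ∀ x (hx : x ∈ J) i, h x i = f ⟨x, hx⟩ i := fun x hx i => dif_pos hx
  have hinj : Set.InjOn h J := by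
    intro x hx y hy hxy
    have : f ⟨x, hx⟩ = f ⟨y, hy⟩ := funext fun i => Fin.ext <| by
      rw [← hval x hx, ← hval y hy, hxy]
    simpa using this
  refine ⟨diffCoord h, diffCoord_comm h, fun i t ht hmono => ?_⟩
  refine hmono.card_le_of_diffCoord (hinj.mono (by exact_mod_cast ht)) fun x hx => ?_
  rw [hval x (ht hx)]
  exact (f _ i).2

end ProductColoring

section DominantColor

variable {V K : Type*} {e : V → V → K} {c : K} {g : V → K}

theorem IsDominant.eq_of_isMonoClique (h : IsDominant e c g) {j : K} (hjc : j ≠ c)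
    {s : Finset V} (hs : IsMonoClique e j s) (hcard : 2 ≤ s.card) : ∀ x ∈ s, g x = j := by
  intro x hx
  obtain ⟨y, hy, hyx⟩ := Finset.exists_mem_ne hcard x
  have hxy := hs hx hy hyx.symm
  rcases h x y hyx.symm with h' | h' <;> grind

theorem IsDominant.hasDisjointCliques (h : IsDominant e c g) {n r : ℕ} {T : Finset K}
    (hT : ∀ j ∈ T, ∃ s : Finset V, n ≤ s.card ∧ ∀ x ∈ s, g x = j) (hr : r ≤ T.card) :
    HasDisjointCliques e c n r := by
  obtain ⟨ι⟩ : Nonempty (Fin r ↪ T) := Function.Embedding.nonempty_of_card_le (by simpa using hr)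
  choose s hs hg using fun i => hT (ι i) (ι i).2
  have φ : ∀ i, Fin n ↪ s i := fun i =>
    Classical.choice (Function.Embedding.nonempty_of_card_le (by simpa using hs i))
  have hgφ : ∀ i a, g (φ i a) = ι i := fun i a => hg i _ (φ i a).2
  have hι : ∀ {i a j b}, g (φ i a) = g (φ j b) → i = j := fun hij =>
    ι.injective (Subtype.ext (by rwa [hgφ, hgφ] at hij))
  refine .of_injective (fun p => φ p.2 p.1) ?_ fun a i j hij => ?_
  · rintro ⟨a, i⟩ ⟨b, j⟩ (heq : (φ i a : V) = φ j b)
    obtain rfl : i = j := hι (congrArg g heq)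
    rw [(φ i).injective (Subtype.ext heq)]
  · exact (h _ _ fun heq => hij (hι (congrArg g heq))).resolve_right fun h' => hij (hι h'.2)

theorem IsDominant.isMonoClique (h : IsDominant e c g) {s : Finset V}
    (hs : (s : Set V).Pairwise fun x y => e x y ≠ c) {x : V} (hx : x ∈ s) :
    IsMonoClique e (g x) s := by
  have hg : ∀ {y z}, y ∈ s → z ∈ s → y ≠ z → e y z = g y ∧ g y = g z := fun hy hz hyz =>
    (h _ _ hyz).resolve_left (hs hy hz hyz)
  intro y hy z hz hyz
  rcases eq_or_ne x y with rfl | hxy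
  · exact (hg hy hz hyz).1
  · rw [(hg hx hy hxy).2, (hg hy hz hyz).1]

end DominantColor

section Glue

variable {V K : Type*} [DecidableEq V] {J : Finset V} {χ ψ : V → V → K} {f : V → K}

/-- The coloring that agrees with `χ` inside `J` and with `ψ` outside `J`, and in which the edges
between `J` and a vertex `x` outside `J` have the color `f x`. -/
def glue (J : Finset V) (χ ψ : V → V → K) (f : V → K) (x y : V) : K :=
  if x ∈ J then if y ∈ J then χ x y else f y else if y ∈ J then f x else ψ x y

theorem glue_comm (hχ : ∀ x y, χ x y = χ y x) (hψ : ∀ x y, ψ x y = ψ y x) (x y : V) :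
    glue J χ ψ f x y = glue J χ ψ f y x := by
  grind [glue]

theorem IsMonoClique.of_glue {i : K} {s : Finset V} (h : IsMonoClique (glue J χ ψ f) i s) {m d : ℕ}
    (hχ : ∀ t ⊆ J, IsMonoClique χ i t → t.card ≤ m)
    (hψ : ∀ t, IsMonoClique ψ i t → (∀ x ∈ t, f x = i) → t.card ≤ d) (hs : m + d < s.card) :
    Disjoint s J ∧ IsMonoClique ψ i s := by
  have hdisj : Disjoint s J := by
    by_contra hmeet
    obtain ⟨x, hx, hxJ⟩ := Finset.not_disjoint_iff.mp hmeet
    have hin := hχ (s ∩ J) Finset.inter_subset_right fun y hy z hz hyz => by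
      have := @h y (by grind) z (by grind) hyz
      grind [glue]
    have hout := hψ (s \ J)
      (fun y hy z hz hyz => by
        have := @h y (by grind) z (by grind) hyz
        grind [glue])
      (fun y hy => by
        have := @h x hx y (by grind) (by grind)
        grind [glue])
    have := Finset.card_inter_add_card_sdiff s J
    omega
  refine ⟨hdisj, fun y hy z hz hyz => ?_⟩
  have := h hy hz hyz
  have := Finset.disjoint_left.mp hdisj hy
  have := Finset.disjoint_left.mp hdisj hz
  grind [glue]

end Glue

section Recoloring

variable {V K : Type*} {e : V → V → K} {c : K} {g : V → K}

theorem IsDominant.exists_recoloring (h : IsDominant e c g) (hs : ∀ x y, e x y = e y x) {r : ℕ}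
    (hr : 2 ≤ r) {a b : K} {J : Finset V} (hJ : J.card ≤ (r - 1) * (r - 2) ^ 2)
    (hit : ∀ j s, j ≠ a → j ≠ b → j ≠ c → s.card = r → IsMonoClique e j s → ¬ Disjoint s J) :
    ∃ e' : V → V → Fin 3, (∀ x y, e' x y = e' y x) ∧
      ∀ i s, s.card = r → IsMonoClique e' i s → IsMonoClique e (![c, a, b] i) s := by
  classical
  obtain ⟨χ, hχs, hχ⟩ := exists_coloring_card_le_of_isMonoClique J ![r - 1, r - 2, r - 2]
    (by simpa [Fin.prod_univ_three, pow_two, mul_assoc] using hJ)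
  let ψ : V → V → Fin 3 := fun x y => if e x y = c then 0 else if e x y = b then 2 else 1
  let f : V → Fin 3 := fun x => if g x = b then 1 else 2
  have hf0 : ∀ x, f x ≠ 0 := fun x => by simp only [f]; split_ifs <;> decide
  have hψ0 : ∀ {x y}, ψ x y = 0 → e x y = c := by grind
  have hψ1 : ∀ {x y}, ψ x y = 1 → e x y ≠ c ∧ e x y ≠ b := by grind
  have hψ2 : ∀ {x y}, ψ x y = 2 → e x y = b := by grind
  have hψf : ∀ {x y}, x ≠ y → ψ x y ≠ f x := fun {x y} hxy => by
    have := h x y hxy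
    grind
  have hempty : ∀ t : Finset V, IsMonoClique ψ 0 t → (∀ x ∈ t, f x = 0) → t.card ≤ 0 := by
    simpa [Finset.eq_empty_iff_forall_notMem] using fun t _ ht x hx => hf0 x (ht x hx)
  have hsmall : ∀ i (t : Finset V), IsMonoClique ψ i t → (∀ x ∈ t, f x = i) → t.card ≤ 1 :=
    fun i t ht hft => Finset.card_le_one.mpr fun x hx y hy => by_contra fun hxy =>
      hψf hxy ((ht hx hy hxy).trans (hft x hx).symm)
  refine ⟨glue J χ ψ f, glue_comm hχs fun x y => by simp only [ψ, hs x y],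
    fun i s hcard hmono => ?_⟩
  match i with
  | 0 =>
    obtain ⟨-, hψs⟩ := hmono.of_glue (hχ 0) hempty (by simp; omega)
    exact fun x hx y hy hxy => hψ0 (hψs hx hy hxy)
  | 1 =>
    obtain ⟨hdisj, hψs⟩ := hmono.of_glue (hχ 1) (hsmall 1) (by simp; omega)
    obtain ⟨x, hx, y, hy, hxy, hψxy⟩ := hψs.exists_color_eq (by omega)
    have hg := h.isMonoClique (fun z hz w hw hzw => (hψ1 (hψs hz hw hzw)).1) hx
    have hne := hψ1 hψxy
    rw [hg hx hy hxy] at hne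
    have hga : g x = a := by_contra fun hga => hit _ s hga hne.2 hne.1 hcard hg hdisj
    exact hga ▸ hg
  | 2 =>
    obtain ⟨-, hψs⟩ := hmono.of_glue (hχ 2) (hsmall 2) (by simp; omega)
    exact fun x hx y hy hxy => hψ2 (hψs hx hy hxy)

theorem exists_erase_erase_card_le [DecidableEq K] [Nonempty K] (T : Finset K) :
    ∃ a b, ((T.erase a).erase b).card ≤ T.card - 2 := by
  have herase : ∀ S : Finset K, ∃ a, (S.erase a).card ≤ S.card - 1 := fun S => by
    obtain rfl | ⟨a, ha⟩ := S.eq_empty_or_nonempty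
    · exact ⟨Classical.arbitrary K, by simp⟩
    · exact ⟨a, (Finset.card_erase_of_mem ha).le⟩
  obtain ⟨a, ha⟩ := herase T
  obtain ⟨b, hb⟩ := herase (T.erase a)
  exact ⟨a, b, by omega⟩

theorem IsDominant.exists_three_coloring [Finite K] (h : IsDominant e c g)
    (hs : ∀ x y, e x y = e y x) {n r : ℕ} (hr : 2 ≤ r) (hnr : n ≤ r - 1)
    (hno : ∀ j, ¬ HasDisjointCliques e j n r) :
    ∃ e' : V → V → Fin 3, (∀ x y, e' x y = e' y x) ∧ ∀ i, ¬ HasDisjointCliques e' i n r := by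
  classical
  have := Fintype.ofFinite K
  have : Nonempty K := ⟨c⟩
  let T : Finset K := {j | j ≠ c ∧ ∃ s : Finset V, s.card = r ∧ IsMonoClique e j s}
  have hT : T.card < r := by
    by_contra! hle
    refine hno c (h.hasDisjointCliques (T := T) (fun j hj => ?_) hle)
    obtain ⟨hjc, s, hcard, hmono⟩ := (Finset.mem_filter.mp hj).2
    exact ⟨s, by omega, h.eq_of_isMonoClique hjc hmono (by omega)⟩
  obtain ⟨a, b, hab⟩ := exists_erase_erase_card_le T
  choose U hU hit using fun j => (hasDisjointCliques_or_exists_hitting_set e j n r).resolve_left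
    (hno j)
  let J : Finset V := ((T.erase a).erase b).biUnion U
  have hJ : J.card ≤ (r - 1) * (r - 2) ^ 2 := calc
    J.card ≤ ((T.erase a).erase b).card * ((n - 1) * r) :=
      Finset.card_biUnion_le_card_mul _ _ _ fun j _ => hU j
    _ ≤ (r - 3) * ((r - 2) * r) :=
      Nat.mul_le_mul (by omega) (Nat.mul_le_mul_right _ (by omega))
    _ ≤ (r - 1) * (r - 2) ^ 2 := by
      obtain rfl | ⟨m, rfl⟩ : r = 2 ∨ ∃ m, r = m + 3 := by
        rcases hr.eq_or_lt with h2 | h3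
        exacts [.inl h2.symm, .inr ⟨r - 3, by omega⟩]
      · simp
      · simp only [Nat.add_sub_cancel, show m + 3 - 2 = m + 1 by omega,
          show m + 3 - 1 = m + 2 by omega]
        nlinarith
  obtain ⟨e', hs', he'⟩ := h.exists_recoloring hs hr (a := a) (b := b) hJ
    fun j s hja hjb hjc hcard hmono hdisj => hit j s hcard hmono <| hdisj.mono_right <|
      Finset.subset_biUnion_of_mem U <| by
        simpa [T, hja, hjb, hjc] using ⟨s, hcard, hmono⟩
  exact ⟨e', hs', fun i hi => hno _ (hi.imp (he' i))⟩

end Recoloring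

section Labelings

variable {V K W : Type*} {C : TopEdgeLabeling V K} {e : V → V → K}

theorem exists_symm_eq_get [Nonempty K] (C : TopEdgeLabeling V K) :
    ∃ e : V → V → K, (∀ x y, e x y = e y x) ∧ ∀ x y (h : x ≠ y), C.get x y h = e x y := by
  classical
  refine ⟨fun x y => if h : x ≠ y then C.get x y h else Classical.arbitrary K, fun x y => ?_,
    fun x y h => (dif_pos h).symm⟩
  by_cases h : x = y
  · rw [h]
  · simpa [h, Ne.symm h] using EdgeLabeling.get_comm y x _

theorem IsMonoClique.hasMonochromaticCopy [Finite W] (hC : ∀ x y (h : x ≠ y), C.get x y h = e x y)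
    {c : K} {s : Finset V} (hs : IsMonoClique e c s) (hcard : Nat.card W ≤ s.card)
    (H : SimpleGraph W) : HasMonochromaticCopy C H := by
  have := Fintype.ofFinite W
  obtain ⟨f⟩ : Nonempty (W ↪ s) :=
    Function.Embedding.nonempty_of_card_le (by simpa [Nat.card_eq_fintype_card] using hcard)
  have hf : Function.Injective fun x => (f x : V) := Subtype.val_injective.comp f.injective
  refine ⟨c, ⟨⟨fun x => f x, fun {x y} hxy => ?_⟩, hf⟩⟩
  have hne := hf.ne hxy.ne
  exact (TopEdgeLabeling.labelGraph_adj ..).mpr ⟨hne, (hC _ _ hne).trans (hs (f x).2 (f y).2 hne)⟩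

theorem HasMonochromaticCopy.of_compRight {K' : Type*} {φ : K → K'} (hφ : Function.Injective φ)
    [Nonempty K] {H : SimpleGraph W} (h : HasMonochromaticCopy (C.compRight φ) H) :
    HasMonochromaticCopy C H := by
  obtain ⟨c, hc⟩ := h
  refine ⟨Function.invFun φ c, hc.mono_right fun x y hxy => ?_⟩
  rw [EdgeLabeling.labelGraph_adj] at hxy ⊢
  obtain ⟨hne, rfl⟩ := hxy
  exact ⟨hne, (Function.leftInverse_invFun hφ _).symm⟩

theorem HasRainbowCopy.card_edgeSet_le [Finite K] {G : SimpleGraph W} (h : HasRainbowCopy C G) :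
    Nat.card G.edgeSet ≤ Nat.card K :=
  let ⟨_, hf⟩ := h
  Nat.card_le_card_of_injective _ hf

theorem HasRainbowCopy.of_compRight {K' : Type*} {φ : K → K'} {G : SimpleGraph W}
    (h : HasRainbowCopy (C.compRight φ) G) : HasRainbowCopy C G :=
  let ⟨f, hf⟩ := h
  ⟨f, Function.Injective.of_comp (f := φ) hf⟩

end Labelings

section Paths

variable {V K : Type*} {n : ℕ}

/-- The edge of the path on `n + 1` vertices that joins the vertices `i` and `i + 1`. -/
def pathEdge (i : Fin n) : (pathGraph (n + 1)).edgeSet :=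
  ⟨s(i.castSucc, i.succ), by simp [pathGraph_adj]⟩

theorem pathEdge_bijective : Function.Bijective (pathEdge (n := n)) := by
  refine ⟨fun i j hij => ?_, fun ⟨ε, hε⟩ => ?_⟩
  · simp only [pathEdge, Subtype.mk.injEq, Sym2.eq_iff, Fin.ext_iff, Fin.val_castSucc,
      Fin.val_succ] at hij
    omega
  · induction ε with | _ x y =>
    rcases pathGraph_adj.mp hε with hxy | hxy
    · exact ⟨⟨x, by lia⟩, Subtype.ext <| Sym2.eq_iff.mpr <| .inl ⟨rfl, Fin.ext hxy⟩⟩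
    · exact ⟨⟨y, by lia⟩, Subtype.ext <| Sym2.eq_iff.mpr <| .inr ⟨rfl, Fin.ext hxy⟩⟩

theorem card_edgeSet_pathGraph : Nat.card (pathGraph (n + 1)).edgeSet = n := by
  rw [← Nat.card_eq_of_bijective _ pathEdge_bijective, Nat.card_fin]

theorem hasRainbowCopy_pathGraph {C : TopEdgeLabeling V K} {e : V → V → K}
    (hC : ∀ x y (h : x ≠ y), C.get x y h = e x y) {v : Fin (n + 1) → V} (hv : Function.Injective v)
    (hcol : Function.Injective fun i : Fin n => e (v i.castSucc) (v i.succ)) :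
    HasRainbowCopy C (pathGraph (n + 1)) := by
  refine ⟨⟨⟨v, fun h => hv.ne h.ne⟩, hv⟩, ?_⟩
  rw [← Function.Injective.of_comp_iff' _ pathEdge_bijective]
  convert hcol using 2 with i
  exact hC _ _ (hv.ne i.castSucc_lt_succ.ne)

theorem rainbowP5Free_of_not_hasRainbowCopy {C : TopEdgeLabeling V K} {e : V → V → K}
    (hC : ∀ x y (h : x ≠ y), C.get x y h = e x y) (h : ¬ HasRainbowCopy C (pathGraph 5)) :
    RainbowP5Free e := by
  intro a b c d f hV hcol
  refine h (hasRainbowCopy_pathGraph hC (List.nodup_iff_injective_get.mp hV) fun i j hij => ?_)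
  refine List.nodup_iff_injective_get.mp hcol (a₁ := i) (a₂ := j) ?_
  fin_cases i <;> fin_cases j <;> exact hij

end Paths

section RamseySets

theorem ramseySet_nonempty (k : ℕ) [NeZero k] {W : Type*} [Finite W] (H : SimpleGraph W) :
    (ramseySet k H).Nonempty := by
  obtain ⟨N, hN⟩ := exists_isMonoClique_of_card_le fun _ : Fin k => Nat.card W
  refine ⟨N, fun C => ?_⟩
  obtain ⟨e, hs, he⟩ := exists_symm_eq_get C
  obtain ⟨c, s, -, hcard, hmono⟩ := hN _ e hs Finset.univ (by simp)
  exact hmono.hasMonochromaticCopy he hcard.ge H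

theorem mem_ramseySet_disjointCopies_iff {k n r N : ℕ} [NeZero k] :
    N ∈ ramseySet k (disjointCopies n (completeGraph (Fin r))) ↔
      ∀ e : Fin N → Fin N → Fin k, (∀ x y, e x y = e y x) → ∃ c, HasDisjointCliques e c n r := by
  refine ⟨fun h e hs => ?_, fun h C => ?_⟩
  · let C : TopEdgeLabeling (Fin N) (Fin k) := EdgeLabeling.mk (fun x y _ => e x y)
      fun x y _ => hs y x
    exact (hasMonochromaticCopy_disjointCopies_iff (C := C) fun x y h => rfl).mp (h C)
  · obtain ⟨e, hs, he⟩ := exists_symm_eq_get C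
    exact (hasMonochromaticCopy_disjointCopies_iff he).mpr (h e hs)

theorem gallaiRamseySet_subset_ramseySet {k m : ℕ} [NeZero m] (hmk : m ≤ k) {U W : Type*}
    {G : SimpleGraph U} {H : SimpleGraph W} (hG : m < Nat.card G.edgeSet) :
    gallaiRamseySet k G H ⊆ ramseySet m H := by
  intro N hN C
  refine .of_compRight (Fin.castLE_injective hmk) ((hN _).resolve_left fun h => hG.not_ge ?_)
  simpa using h.of_compRight.card_edgeSet_le

theorem pow_lt_of_mem_ramseySet {k n r N : ℕ} [NeZero k] (hn : 1 ≤ n) (hr : 1 ≤ r)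
    (hN : N ∈ ramseySet k (disjointCopies n (completeGraph (Fin r)))) : (r - 1) ^ k < N := by
  by_contra! hle
  obtain ⟨χ, hχs, hχ⟩ := exists_coloring_card_le_of_isMonoClique (Finset.univ : Finset (Fin N))
    (fun _ : Fin k => r - 1) (by simpa using hle)
  obtain ⟨c, s, hs, -⟩ := mem_ramseySet_disjointCopies_iff.mp hN χ hχs
  have := hχ c _ (Finset.subset_univ _) (hs ⟨0, hn⟩).2
  have := (hs ⟨0, hn⟩).1
  omega

theorem RainbowP5Free.exists_hasDisjointCliques {K : Type*} [Finite K] {n r N : ℕ} (hr : 3 ≤ r)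
    (hn : 1 ≤ n) (hnr : n ≤ r - 1)
    (hN : N ∈ ramseySet 3 (disjointCopies n (completeGraph (Fin r))))
    {e : Fin N → Fin N → K} (he : RainbowP5Free e) (hs : ∀ x y, e x y = e y x) :
    ∃ c, HasDisjointCliques e c n r := by
  have hlt := pow_lt_of_mem_ramseySet hn (by omega) hN
  have hramsey := mem_ramseySet_disjointCopies_iff.mp hN
  obtain ⟨m, rfl⟩ : ∃ m, r = m + 3 := ⟨r - 3, by omega⟩
  rw [show m + 3 - 1 = m + 2 by omega] at hlt hnr
  have hN6 : 6 ≤ N := by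
    have : 2 ^ 3 ≤ (m + 2) ^ 3 := Nat.pow_le_pow_left (by omega) 3
    omega
  have hN3 : n * (m + 3) + 3 ≤ N := by
    have : n * (m + 3) ≤ (m + 2) * (m + 3) := Nat.mul_le_mul_right _ hnr
    nlinarith
  rcases (he.rainbowFourFree hs (by simpa)).trichotomy hs (by simpa) with
    ⟨T, hT, heT⟩ | ⟨c, g, hdom⟩ | ⟨S, hS, c, hc⟩
  · obtain ⟨φ, -, hφ⟩ := T.finite_toSet.exists_injOn_of_encard_le
      (t := (Set.univ : Set (Fin 3))) (by simpa using hT)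
    obtain ⟨c, hc⟩ := hramsey (fun x y => φ (e x y)) fun x y => by rw [hs]
    exact exists_hasDisjointCliques_of_comp hφ heT hn (by omega) hc
  · by_contra! hno
    obtain ⟨e', hs', hno'⟩ := hdom.exists_three_coloring hs (by omega) hnr hno
    obtain ⟨c', hc'⟩ := hramsey e' hs'
    exact hno' c' hc'
  · refine ⟨c, IsMonoClique.hasDisjointCliques (s := Sᶜ) (fun x hx y hy hxy => ?_) ?_⟩
    · exact hc x (by simpa using hx) y (by simpa using hy) hxy
    · rw [Finset.card_compl, Fintype.card_fin]
      omega

theorem ramseySet_subset_gallaiRamseySet {k n r : ℕ} [NeZero k] (hr : 3 ≤ r) (hn : 1 ≤ n)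
    (hnr : n ≤ r - 1) :
    ramseySet 3 (disjointCopies n (completeGraph (Fin r))) ⊆
      gallaiRamseySet k (pathGraph 5) (disjointCopies n (completeGraph (Fin r))) := by
  intro N hN C
  obtain ⟨e, hs, he⟩ := exists_symm_eq_get C
  refine or_iff_not_imp_left.mpr fun hC => (hasMonochromaticCopy_disjointCopies_iff he).mpr ?_
  exact (rainbowP5Free_of_not_hasRainbowCopy he hC).exists_hasDisjointCliques hr hn hnr hN hs

end RamseySets

theorem mainTheorem7_general (r n : ℕ) (hr : 3 ≤ r) (hn : 1 ≤ n) (hnr : n ≤ r - 1) :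
    (ramseySet 3 (disjointCopies n (completeGraph (Fin r)))).Nonempty ∧
    ∀ k : ℕ, 1 ≤ k →
      (gallaiRamseySet k (pathGraph 5) (disjointCopies n (completeGraph (Fin r)))).Nonempty ∧
      gallaiRamseyNumber k (pathGraph 5) (disjointCopies n (completeGraph (Fin r))) ≤
        ramseyNumber 3 (disjointCopies n (completeGraph (Fin r))) ∧
      (3 ≤ k →
        gallaiRamseyNumber k (pathGraph 5) (disjointCopies n (completeGraph (Fin r))) =
          ramseyNumber 3 (disjointCopies n (completeGraph (Fin r)))) := by
  have hne := ramseySet_nonempty 3 (disjointCopies n (completeGraph (Fin r)))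
  refine ⟨hne, fun k hk => ?_⟩
  have : NeZero k := ⟨by omega⟩
  have hsub := ramseySet_subset_gallaiRamseySet (k := k) hr hn hnr
  have hle := Nat.sInf_le (hsub (Nat.sInf_mem hne))
  refine ⟨hne.mono hsub, hle, fun hk3 => hle.antisymm (Nat.sInf_le ?_)⟩
  exact gallaiRamseySet_subset_ramseySet hk3 (by rw [card_edgeSet_pathGraph]; norm_num)
    (Nat.sInf_mem (hne.mono hsub))

theorem mainTheorem7 (r n : ℕ) (hr : 3 ≤ r) (hn : 2 ≤ n) (hnr : n ≤ r - 1) :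
    (ramseySet 3 (disjointCopies n (completeGraph (Fin r)))).Nonempty ∧
    ∀ k : ℕ, 1 ≤ k →
      (gallaiRamseySet k (pathGraph 5) (disjointCopies n (completeGraph (Fin r)))).Nonempty ∧
      gallaiRamseyNumber k (pathGraph 5) (disjointCopies n (completeGraph (Fin r))) ≤
        ramseyNumber 3 (disjointCopies n (completeGraph (Fin r))) ∧
      (3 ≤ k →
        gallaiRamseyNumber k (pathGraph 5) (disjointCopies n (completeGraph (Fin r))) =
          ramseyNumber 3 (disjointCopies n (completeGraph (Fin r)))) :=
  mainTheorem7_general r n hr (by omega) hnr
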